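/- **Setting.** Let $\mathcal A=\{a_1,\dots,a_n\}$ be a set of $n$ arms and $\mathcal S$ the collection of its $k$-element subsets. For every $s\in\mathcal S$ there is a fixed, unknown joint distribution of a reward vector $(X_{i,s})_{a_i\in s}$ with $X_{i,s}\in[0,B]$ almost surely (the rewards of the arms of $s$ may depend on each other arbitrarily). Put $Q(s)=\sum_{a_i\in s}X_{i,s}$, let $s^*\in\arg\max_{s\in\mathcal S}\mathbb E[Q(s)]$, and let $\epsilon=\min_{s\in\mathcal S,\,s\ne s^*}\mathbb E[Q(s^*)-Q(s)]$. Assume extended weak optimal set consistency: for every $s\in\mathcal S$ with $s\neq s^*$ and every $a_i\in s\cap s^*$, $\mathbb E[X_{i,s}]\ge\mathbb E[X_{i,s^*}]$. **Algorithm.** Fix a horizon $T\ge 2$ and a parameter $\alpha\ge 2$. At each time $t=1,\dots,T$ let $N_i(t)$ be the number of earlier rounds in which $a_i$ was in the selected set, $C_i(t)$ the total reward of $a_i$ observed in those rounds, and $$\mathrm{UCB}_i(t)=\frac{C_i(t)}{N_i(t)}+B\sqrt{\frac{\alpha\log T}{N_i(t)}}\ \text{ if } N_i(t)\ge 1,\qquad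 \mathrm{UCB}_i(t)=+\infty\ \text{ if } N_i(t)=0 .$$ The learner selects a set $s(t)$ of $k$ arms with the $k$ largest values $\mathrm{UCB}_i(t)$, ties being broken in any, possibly randomized, way that uses no information about the present or future rewards. Then the reward vector $(X_{i,s(t)})_{a_i\in s(t)}$ is drawn, given the past and $s(t)$, from the distribution attached to $s(t)$, and all its entries are observed. The regret is $R(T)=\sum_{t=1}^T\mathbb E\left[Q(s^*)-Q(s(t))\right]$. **Claim.** There is a universal constant $K>0$, independent of $n,k,B,T,\alpha$, the reward distributions and the tie-breaking, such that always $$R(T)\le K\,k^2B\sqrt{\alpha nT\log T},$$ and, if $\epsilon>0$, $$R(T)\le K\min\left(\frac{\alpha k^2B^2n\log T}{\epsilon},\;k^2B\sqrt{\alpha nT\log T}\right).$$ -/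

import Mathlib

open MeasureTheory ProbabilityTheory

noncomputable section

namespace SetBandit

/-- The sets the learner can select: the `k`-element subsets of the `n` arms. -/
abbrev KSet (n k : ℕ) := {s : Finset (Fin n) // s.card = k}

/-- A set-dependent reward model with rewards in `[0, B]`. For each selectable set `s`, `law s` is
the joint law of the reward vector `(X_{i,s})`; only the coordinates `i ∈ s` are meaningful, and
their dependence on each other is arbitrary. -/
structure RewardModel (n k : ℕ) (B : ℝ) where
  law : KSet n k → Measure (Fin n → ℝ)
  isProb : ∀ s, IsProbabilityMeasure (law s)
  bounded : ∀ s, ∀ i ∈ s.1, ∀ᵐ x ∂(law s), x i ∈ Set.Icc 0 B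

namespace RewardModel

variable {n k : ℕ} {B : ℝ}

/-- `E[X_{i,s}]`. -/
def armMean (M : RewardModel n k B) (s : KSet n k) (i : Fin n) : ℝ :=
  ∫ x, x i ∂(M.law s)

/-- `E[Q(s)]`, the expected total reward of the set `s`. -/
def setMean (M : RewardModel n k B) (s : KSet n k) : ℝ :=
  ∫ x, ∑ i ∈ s.1, x i ∂(M.law s)

/-- `s` maximizes the expected total reward. -/
def IsOptimalSet (M : RewardModel n k B) (s : KSet n k) : Prop :=
  ∀ s' : KSet n k, M.setMean s' ≤ M.setMean s

/-- Extended weak optimal set consistency: an arm of the optimal set `sstar` has, in every other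
set that contains it, an expected reward at least as large as in `sstar`. -/
def WeakOptimalSetConsistency (M : RewardModel n k B) (sstar : KSet n k) : Prop :=
  ∀ s : KSet n k, s ≠ sstar → ∀ i ∈ s.1 ∩ sstar.1, M.armMean sstar i ≤ M.armMean s i

/-- The gap `ε = min_{s ≠ sstar} E[Q(sstar) - Q(s)]` (there are finitely many sets; if `sstar` is
the only set, the value is `0`). -/
def gap (M : RewardModel n k B) (sstar : KSet n k) : ℝ :=
  ⨅ s : {s : KSet n k // s ≠ sstar}, (M.setMean sstar - M.setMean s.1)

end RewardModel

section Algorithm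

variable {n k : ℕ} {Ω : Type*}

/-- `N_i(t)`: how often arm `i` was selected strictly before time `t`. Times start at `0`. -/
def pulls (S : ℕ → Ω → KSet n k) (t : ℕ) (ω : Ω) (i : Fin n) : ℕ :=
  ((Finset.range t).filter (fun c => i ∈ (S c ω).1)).card

/-- `C_i(t)`: the cumulative observed reward of arm `i` strictly before time `t`. -/
def cumReward (S : ℕ → Ω → KSet n k) (X : ℕ → Ω → Fin n → ℝ) (t : ℕ) (ω : Ω) (i : Fin n) : ℝ :=
  ∑ c ∈ (Finset.range t).filter (fun c => i ∈ (S c ω).1), X c ω i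

/-- `UCB_i(t)` with exploration bonus `B √(α log T / N_i(t))`, infinite for an arm that was never
selected. It changes only when the arm is selected. -/
def ucb (B α : ℝ) (T : ℕ) (S : ℕ → Ω → KSet n k) (X : ℕ → Ω → Fin n → ℝ)
    (t : ℕ) (ω : Ω) (i : Fin n) : EReal :=
  if pulls S t ω i = 0 then ⊤
  else ((cumReward S X t ω i / (pulls S t ω i : ℝ)
    + B * Real.sqrt (α * Real.log (T : ℝ) / (pulls S t ω i : ℝ)) : ℝ) : EReal)

/-- `(S, X)` is a run over the horizon `T` of the UCB algorithm with parameter `α` against the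
reward model `M`: `S t` is the set selected at time `t` and `X t` the reward vector drawn then.
`ℱ t` is the information available when `S t` is selected, including the internal randomness of the
learner, so ties may be broken in any non-anticipating, possibly randomized way. -/
structure IsUCBRun {B : ℝ} (M : RewardModel n k B) (α : ℝ) (T : ℕ) {mΩ : MeasurableSpace Ω}
    (P : Measure Ω) (ℱ : Filtration ℕ mΩ)
    (S : ℕ → Ω → KSet n k) (X : ℕ → Ω → Fin n → ℝ) : Prop where
  /-- The selection is made on the basis of the available information. -/
  measurable_S : ∀ t < T, ∀ s : KSet n k, MeasurableSet[ℱ t] {ω | S t ω = s}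
  /-- The rewards of a round are known after the round. -/
  measurable_X : ∀ t < T, Measurable[ℱ (t + 1)] (X t)
  /-- Given the past and the selection `S t = s`, the reward vector has law `M.law s`. -/
  cond_law : ∀ t < T, ∀ s : KSet n k, ∀ A : Set Ω, MeasurableSet[ℱ t] A →
    ∀ E : Set (Fin n → ℝ), MeasurableSet E →
      P (A ∩ {ω | S t ω = s} ∩ X t ⁻¹' E) = P (A ∩ {ω | S t ω = s}) * M.law s E
  /-- The selected set consists of `k` arms with the largest upper confidence bounds. -/
  top_k : ∀ t < T, ∀ᵐ ω ∂P, ∀ i ∈ (S t ω).1, ∀ j ∉ (S t ω).1,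
    ucb B α T S X t ω j ≤ ucb B α T S X t ω i

/-- `R(T) = ∑_t E[Q(sstar) - Q(s(t))]`, where `Q(s(t))` is the reward collected in round `t`. -/
def regret {B : ℝ} (M : RewardModel n k B) (sstar : KSet n k) (T : ℕ) {mΩ : MeasurableSpace Ω}
    (P : Measure Ω) (S : ℕ → Ω → KSet n k) (X : ℕ → Ω → Fin n → ℝ) : ℝ :=
  ∑ t ∈ Finset.range T, (M.setMean sstar - ∫ ω, ∑ i ∈ (S t ω).1, X t ω i ∂P)

end Algorithm

end SetBandit

end

/-! The argument is pathwise. Suppose that each arm's observed reward sum stays within `B √(α log T)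
√N` of the sum of its conditional means. Order the optimal arms by their means `ν 0 ≥ … ≥ ν (k-1)`
in the optimal set, and let the window of stage `a` end just after the last round that misses one of
the first `a + 1` of them. By consistency, an arm missed in that round has a UCB of at least `ν a`.
The UCB of an unselected arm is frozen, so every arm selected earlier in the window also had a UCB
of at least `ν a` (`ucb_le_ucb_of_notMem`), and its accumulated mean is at least `ν a` per pull, up
to a multiple of the confidence width.

Summing over arms, with Cauchy–Schwarz for the widths, bounds the window's regret by `O(B √(α log T)
√(nkD))`, where `D` counts its suboptimal rounds, plus the cost of missing better optimal arms
(`window_regret_le`). Such misses lie in earlier windows, and the worse optimal arms give a negative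
term. `sum_mul_sub_le_sum` plays these terms off against each other and eliminates the `ν`: the
regret of the path is at most the width of the last stage plus, for each earlier stage, its width
minus its own regret (`exists_path_regret_le`). Dropping the subtracted regrets gives the
square-root bound; bounding them below by `ε D` and optimizing over `D` gives the gap bound.

Concentration fails with probability at most `2n/T²`, by Hoeffding's lemma, an exponential
supermartingale and a union bound. The resulting cost is `O(kB)` when `n ≤ T`; when `n > T` the
trivial bound `kBT` suffices. -/

namespace SetBandit

/-! ### A summation inequality -/

/-- If `c a * ∑_{l > a} (ν a - ν l) ≤ E a + ∑_{l < a} c l * (ν l - ν a)` for all `a`, then the last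
sum on the right is at most `∑ E a`. -/
theorem sum_mul_sub_le_sum {k : ℕ} (ν c E : ℕ → ℝ)
    (h : ∀ a < k, c a * ∑ l ∈ Finset.Ico (a + 1) (k + 1), (ν a - ν l) ≤
      E a + ∑ l ∈ Finset.range a, c l * (ν l - ν a)) :
    ∑ l ∈ Finset.range k, c l * (ν l - ν k) ≤ ∑ a ∈ Finset.range k, E a := by
  -- Strengthened invariant. With `d = ν a - ν (a+1)`, the first sum grows by `d` times the sum of
  -- `c` up to `a`, and the tail sum loses `(k - a) * d`; these changes cancel, so the increment is
  -- exactly what the hypothesis at `a` bounds. At `a = k` the factor is `1` and the tail sum is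
  -- empty. No signs are needed.
  have key : ∀ a ≤ k, ((k : ℝ) + 1 - a) * (∑ l ∈ Finset.range a, c l * (ν l - ν a)) +
      (∑ l ∈ Finset.Ico (a + 1) (k + 1), (ν a - ν l)) * (∑ l ∈ Finset.range a, c l) ≤
      ∑ b ∈ Finset.range a, E b := by
    intro a
    induction a with
    | zero => intro _; simp
    | succ a ih =>
      intro ha
      have h1 := ih (by omega)
      have h2 := h a (by omega)
      have hY : ∑ l ∈ Finset.range (a + 1), c l * (ν l - ν (a + 1)) =
          (∑ l ∈ Finset.range a, c l * (ν l - ν a)) +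
            (∑ l ∈ Finset.range (a + 1), c l) * (ν a - ν (a + 1)) := by
        have : ∀ l, c l * (ν l - ν (a + 1)) = c l * (ν l - ν a) + c l * (ν a - ν (a + 1)) := by
          intro l; ring
        rw [Finset.sum_congr rfl fun l _ => this l, Finset.sum_add_distrib, ← Finset.sum_mul]
        rw [Finset.sum_range_succ (fun l => c l * (ν l - ν a))]
        ring
      have hG : ∑ l ∈ Finset.Ico (a + 1) (k + 1), (ν a - ν l) =
          ((k : ℝ) - a) * (ν a - ν (a + 1)) +
            ∑ l ∈ Finset.Ico (a + 1 + 1) (k + 1), (ν (a + 1) - ν l) := by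
        have e1 : ∀ l, ν a - ν l = (ν a - ν (a + 1)) + (ν (a + 1) - ν l) := by intro l; ring
        rw [Finset.sum_congr rfl fun l _ => e1 l, Finset.sum_add_distrib, Finset.sum_const, Nat.card_Ico, nsmul_eq_mul,
          Finset.sum_eq_sum_Ico_succ_bot (show a + 1 < k + 1 by omega)]
        have : ((k + 1 - (a + 1) : ℕ) : ℝ) = (k : ℝ) - a := by
          rw [Nat.cast_sub (by omega)]; push_cast; ring
        rw [this]; ring
      rw [hY, Finset.sum_range_succ E, Finset.sum_range_succ c]
      rw [hG] at h1 h2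
      push_cast
      generalize ∑ l ∈ Finset.range a, c l * (ν l - ν a) = Y at *
      generalize ∑ l ∈ Finset.Ico (a + 1 + 1) (k + 1), (ν (a + 1) - ν l) = G at *
      generalize ∑ l ∈ Finset.range a, c l = C at *
      nlinarith
  have := key k le_rfl
  simpa using this

/-- The elements of a nonempty finite set can be listed in the order of decreasing values. -/
theorem exists_antitone_enumeration {α : Type*} [DecidableEq α] (μ : α → ℝ) [Inhabited α] :
    ∀ (m : ℕ) (s : Finset α), s.card = m → ∃ p : ℕ → α, Set.InjOn p (Finset.range m) ∧
      (Finset.range m).image p = s ∧ ∀ a b, a ≤ b → b < m → μ (p b) ≤ μ (p a) := by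
  intro m
  induction m with
  | zero =>
    intro s hs
    refine ⟨fun _ => default, by simp, ?_, by intros; omega⟩
    simp [Finset.card_eq_zero.1 hs]
  | succ m ih =>
    intro s hs
    obtain ⟨x, hx, hmin⟩ := s.exists_min_image μ (Finset.card_pos.1 (by omega))
    obtain ⟨p, hp1, hp2, hp3⟩ := ih (s.erase x) (by rw [Finset.card_erase_of_mem hx]; omega)
    have hmem : ∀ a < m, p a ∈ s.erase x := fun a ha => by
      rw [← hp2]; exact Finset.mem_image_of_mem _ (Finset.mem_range.2 ha)
    refine ⟨fun a => if a < m then p a else x, ?_, ?_, ?_⟩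
    · intro a ha b hb hab
      simp only [Finset.coe_range, Set.mem_Iio] at ha hb
      by_cases h1 : a < m <;> by_cases h2 : b < m <;> simp only [h1, h2, if_true, if_false] at hab
      · exact hp1 (by simpa using h1) (by simpa using h2) hab
      · exact absurd hab (Finset.ne_of_mem_erase (hmem a h1))
      · exact absurd hab.symm (Finset.ne_of_mem_erase (hmem b h2))
      · omega
    · rw [Finset.range_add_one, Finset.image_insert, if_neg (lt_irrefl m)]
      have : (Finset.range m).image (fun a => if a < m then p a else x) =
          (Finset.range m).image p := by
        apply Finset.image_congr
        intro a ha
        have : a < m := by simpa using ha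
        simp [this]
      rw [this, hp2, Finset.insert_erase hx]
    · intro a b hab hb
      by_cases h2 : b < m
      · simp only [h2, show a < m by omega, if_true]
        exact hp3 a b hab h2
      · simp only [h2, if_false]
        split_ifs with h1
        · exact hmin _ (Finset.mem_of_mem_erase (hmem a h1))
        · exact le_rfl

/-- Supplies the ends of the windows: `u` is one past the last occurrence of `Q`, and `0` (an empty
window) if there is none. -/
theorem exists_last_time (Q : ℕ → Prop) (T : ℕ) :
    ∃ u ≤ T, (u = 0 ∨ ∃ t, u = t + 1 ∧ Q t) ∧ ∀ t < T, Q t → t < u := by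
  induction T with
  | zero => exact ⟨0, le_rfl, Or.inl rfl, by intros; omega⟩
  | succ T ih =>
    obtain ⟨u, hu, h1, h2⟩ := ih
    by_cases hQ : Q T
    · exact ⟨T + 1, le_rfl, Or.inr ⟨T, rfl, hQ⟩, fun t ht _ => ht⟩
    · refine ⟨u, by omega, h1, fun t ht hq => h2 t ?_ hq⟩
      rcases Nat.lt_succ_iff_lt_or_eq.1 ht with h | h
      · exact h
      · exact absurd (h ▸ hq) hQ

/-! ### Means -/

namespace RewardModel

variable {n k : ℕ} {B : ℝ} (M : RewardModel n k B)

theorem integrable_coord (s : KSet n k) {i : Fin n} (hi : i ∈ s.1) :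
    Integrable (fun x : Fin n → ℝ => x i) (M.law s) := by
  have := M.isProb s
  refine Integrable.of_mem_Icc 0 B (measurable_pi_apply i).aemeasurable (M.bounded s i hi)

theorem armMean_nonneg (s : KSet n k) {i : Fin n} (hi : i ∈ s.1) : 0 ≤ M.armMean s i :=
  integral_nonneg_of_ae ((M.bounded s i hi).mono fun _ h => h.1)

theorem armMean_le (s : KSet n k) {i : Fin n} (hi : i ∈ s.1) : M.armMean s i ≤ B := by
  have := M.isProb s
  calc M.armMean s i ≤ ∫ _, B ∂(M.law s) :=
        integral_mono_ae (M.integrable_coord s hi) (integrable_const _)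
          ((M.bounded s i hi).mono fun _ h => h.2)
    _ = B := by simp

theorem setMean_eq_sum (s : KSet n k) : M.setMean s = ∑ i ∈ s.1, M.armMean s i :=
  integral_finsetSum _ fun _ hi => M.integrable_coord s hi

theorem setMean_nonneg (s : KSet n k) : 0 ≤ M.setMean s := by
  rw [setMean_eq_sum]; exact Finset.sum_nonneg fun i hi => M.armMean_nonneg s hi

theorem setMean_le (s : KSet n k) : M.setMean s ≤ k * B := by
  rw [setMean_eq_sum]
  calc ∑ i ∈ s.1, M.armMean s i ≤ ∑ i ∈ s.1, B := Finset.sum_le_sum fun i hi => M.armMean_le s hi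
    _ = k * B := by rw [Finset.sum_const, s.2, nsmul_eq_mul]

theorem bound_nonneg (M : RewardModel n k B) (s : KSet n k) (hk : 0 < k) : 0 ≤ B := by
  obtain ⟨i, hi⟩ := Finset.card_pos.1 (s.2.symm ▸ hk)
  exact (M.armMean_nonneg s hi).trans (M.armMean_le s hi)

theorem armMean_le_of_consistent {sstar : KSet n k} (hc : M.WeakOptimalSetConsistency sstar)
    {s : KSet n k} {i : Fin n} (hi : i ∈ s.1) (hi' : i ∈ sstar.1) :
    M.armMean sstar i ≤ M.armMean s i := by
  by_cases h : s = sstar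
  · rw [h]
  · exact hc s h i (Finset.mem_inter.2 ⟨hi, hi'⟩)

theorem gap_le (sstar s : KSet n k) (h : s ≠ sstar) :
    M.gap sstar ≤ M.setMean sstar - M.setMean s :=
  ciInf_le (f := fun s : {s : KSet n k // s ≠ sstar} => M.setMean sstar - M.setMean s.1)
    (Set.finite_range _).bddBelow ⟨s, h⟩

/-- Lets costs of order `kB` be absorbed into a bound with the gap in the denominator. Positivity of
the gap rules out the empty infimum, whose value is `0`. -/
theorem gap_le_bound (sstar : KSet n k) (h : 0 < M.gap sstar) : M.gap sstar ≤ k * B := by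
  by_cases hne : ∃ s, s ≠ sstar
  · obtain ⟨s, hs⟩ := hne
    have := M.gap_le sstar s hs
    have := M.setMean_le sstar
    have := M.setMean_nonneg s
    linarith
  · push Not at hne
    have : IsEmpty {s : KSet n k // s ≠ sstar} := ⟨fun s => s.2 (hne s.1)⟩
    simp [gap, Real.iInf_of_isEmpty] at h

end RewardModel

/-! ### Pathwise analysis of the upper confidence bounds -/

section Pathwise

variable {n k : ℕ} {Ω : Type*} {B : ℝ}

/-- The sum of the expectations of the rewards of arm `i` observed before time `t`. -/
noncomputable def cumMean (M : RewardModel n k B) (S : ℕ → Ω → KSet n k) (t : ℕ) (ω : Ω) (i : Fin n) : ℝ :=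
  ∑ c ∈ (Finset.range t).filter (fun c => i ∈ (S c ω).1), M.armMean (S c ω) i

variable (M : RewardModel n k B) (α : ℝ) (T : ℕ) (S : ℕ → Ω → KSet n k)
  (X : ℕ → Ω → Fin n → ℝ) (ω : Ω)

theorem pulls_succ_of_mem {t : ℕ} {i : Fin n} (h : i ∈ (S t ω).1) :
    pulls S (t + 1) ω i = pulls S t ω i + 1 := by
  unfold pulls
  rw [Finset.range_add_one, Finset.filter_insert, if_pos h, Finset.card_insert_of_notMem (by simp)]

theorem pulls_succ_of_notMem {t : ℕ} {i : Fin n} (h : i ∉ (S t ω).1) :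
    pulls S (t + 1) ω i = pulls S t ω i := by
  unfold pulls
  rw [Finset.range_add_one, Finset.filter_insert, if_neg h]

theorem cumReward_succ_of_mem {t : ℕ} {i : Fin n} (h : i ∈ (S t ω).1) :
    cumReward S X (t + 1) ω i = X t ω i + cumReward S X t ω i := by
  unfold cumReward
  rw [Finset.range_add_one, Finset.filter_insert, if_pos h, Finset.sum_insert (by simp)]

theorem cumReward_succ_of_notMem {t : ℕ} {i : Fin n} (h : i ∉ (S t ω).1) :
    cumReward S X (t + 1) ω i = cumReward S X t ω i := by
  unfold cumReward
  rw [Finset.range_add_one, Finset.filter_insert, if_neg h]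

theorem cumMean_succ_of_mem {t : ℕ} {i : Fin n} (h : i ∈ (S t ω).1) :
    cumMean M S (t + 1) ω i = M.armMean (S t ω) i + cumMean M S t ω i := by
  unfold cumMean
  rw [Finset.range_add_one, Finset.filter_insert, if_pos h, Finset.sum_insert (by simp)]

theorem cumMean_succ_of_notMem {t : ℕ} {i : Fin n} (h : i ∉ (S t ω).1) :
    cumMean M S (t + 1) ω i = cumMean M S t ω i := by
  unfold cumMean
  rw [Finset.range_add_one, Finset.filter_insert, if_neg h]

theorem ucb_succ_of_notMem {t : ℕ} {i : Fin n} (h : i ∉ (S t ω).1) :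
    ucb B α T S X (t + 1) ω i = ucb B α T S X t ω i := by
  unfold ucb
  rw [pulls_succ_of_notMem S ω h, cumReward_succ_of_notMem S X ω h]

/-- The largest upper confidence bound of an arm that is not selected does not increase. -/
theorem ucb_le_ucb_of_notMem
    (htop : ∀ t < T, ∀ i ∈ (S t ω).1, ∀ j ∉ (S t ω).1,
      ucb B α T S X t ω j ≤ ucb B α T S X t ω i)
    {s t : ℕ} (hst : s ≤ t) (ht : t < T) {i : Fin n} (hi : i ∈ (S s ω).1) :
    ∀ j ∉ (S t ω).1, ucb B α T S X t ω j ≤ ucb B α T S X s ω i := by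
  induction t, hst using Nat.le_induction with
  | base => exact htop s ht i hi
  | succ t hst ih =>
    have ih := ih (by omega)
    intro j hj
    by_contra! hlt
    have hall : ∀ a ∈ insert j (S (t + 1) ω).1,
        ucb B α T S X s ω i < ucb B α T S X (t + 1) ω a := by
      intro a ha
      rcases Finset.mem_insert.1 ha with rfl | ha
      · exact hlt
      · exact hlt.trans_le (htop _ ht a ha j hj)
    -- Pigeonhole: `k + 1` arms exceed the level at time `t + 1`, so one of them was not selected at
    -- time `t`. Its UCB has not changed since, against the induction hypothesis.
    have hcard : (S t ω).1.card < (insert j (S (t + 1) ω).1).card := by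
      rw [Finset.card_insert_of_notMem hj, (S t ω).2, (S (t + 1) ω).2]; omega
    obtain ⟨a, ha, ha'⟩ := Finset.exists_mem_notMem_of_card_lt_card hcard
    have := hall a ha
    rw [ucb_succ_of_notMem α T S X ω ha'] at this
    exact absurd (ih a ha') (not_le.2 this)

theorem mul_bonus (N : ℕ) (hN : N ≠ 0) :
    (N : ℝ) * (B * Real.sqrt (α * Real.log T / N)) =
      B * Real.sqrt (α * Real.log T) * Real.sqrt N := by
  have hN' : (0 : ℝ) < N := by positivity
  rw [Real.sqrt_div' _ hN'.le]
  have : Real.sqrt (N : ℝ) ≠ 0 := (Real.sqrt_pos.2 hN').ne'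
  field_simp
  rw [Real.sq_sqrt hN'.le]; ring

/-- Concentration of the reward sums around the sums of the expectations, up to time `T`. -/
def Concentrated : Prop :=
  ∀ t < T, ∀ i, |cumReward S X t ω i - cumMean M S t ω i| ≤
    B * Real.sqrt (α * Real.log T) * Real.sqrt (pulls S t ω i)

variable {M α T S X ω}

/-- Optimism survives the changing reward laws: by consistency every observation of an optimal arm
has a mean no smaller than in `sstar`, and the bonus covers the fluctuation. -/
theorem armMean_le_ucb {sstar : KSet n k} (hc : M.WeakOptimalSetConsistency sstar)
    (hg : Concentrated M α T S X ω) {t : ℕ} (ht : t < T) {i : Fin n} (hi : i ∈ sstar.1) :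
    (M.armMean sstar i : EReal) ≤ ucb B α T S X t ω i := by
  unfold ucb
  split_ifs with h0
  · exact le_top
  · rw [EReal.coe_le_coe_iff]
    have hN : (0 : ℝ) < pulls S t ω i := by positivity
    have h1 := (abs_le.1 (hg t ht i)).1
    have h2 : (pulls S t ω i : ℝ) * M.armMean sstar i ≤ cumMean M S t ω i := by
      unfold cumMean pulls
      rw [← nsmul_eq_mul]
      apply Finset.card_nsmul_le_sum
      intro c hc'
      exact M.armMean_le_of_consistent hc (Finset.mem_filter.1 hc').2 hi
    have h3 := mul_bonus (B := B) α T _ h0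
    refine le_of_mul_le_mul_left ?_ hN
    rw [mul_add, h3, mul_div_cancel₀ _ hN.ne']
    linarith

/-- The UCB exceeds the average of the conditional means by at most two bonuses, one for the index
itself and one for the deviation. -/
theorem mul_pulls_le_cumMean_of_le_ucb (hg : Concentrated M α T S X ω) {t : ℕ} (ht : t < T)
    {i : Fin n} {θ : ℝ} (h : (θ : EReal) ≤ ucb B α T S X t ω i) :
    θ * pulls S t ω i - 2 * (B * Real.sqrt (α * Real.log T)) * Real.sqrt (pulls S t ω i) ≤
      cumMean M S t ω i := by
  unfold ucb at h
  split_ifs at h with h0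
  · have : cumMean M S t ω i = 0 := by
      unfold cumMean
      unfold pulls at h0
      rw [Finset.card_eq_zero.1 h0, Finset.sum_empty]
    rw [h0, this]; simp
  · rw [EReal.coe_le_coe_iff] at h
    have hN : (0 : ℝ) < pulls S t ω i := by positivity
    have h1 := (abs_le.1 (hg t ht i)).2
    have h3 := mul_bonus (B := B) α T _ h0
    have := mul_le_mul_of_nonneg_left h hN.le
    rw [mul_add, h3, mul_div_cancel₀ _ hN.ne'] at this
    linarith

/-- The UCB is only controlled just before a selection, so the round of the last selection is
uncovered. It costs at most `θ ≤ B`, which a third width pays for. -/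
theorem mul_pulls_le_cumMean (hg : Concentrated M α T S X ω) (hB : 0 ≤ B)
    (hα : 1 ≤ Real.sqrt (α * Real.log T)) {u : ℕ} (hu : u ≤ T) {i : Fin n} {θ : ℝ} (hθ : θ ≤ B)
    (h : ∀ s < u, i ∈ (S s ω).1 → (θ : EReal) ≤ ucb B α T S X s ω i) :
    θ * pulls S u ω i - 3 * (B * Real.sqrt (α * Real.log T)) * Real.sqrt (pulls S u ω i) ≤
      cumMean M S u ω i := by
  induction u with
  | zero => simp [pulls, cumMean]
  | succ u ih =>
    by_cases hi : i ∈ (S u ω).1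
    · have h1 := mul_pulls_le_cumMean_of_le_ucb hg (by omega) (h u (by omega) hi)
      rw [pulls_succ_of_mem S ω hi, cumMean_succ_of_mem M S ω hi]
      have h2 := M.armMean_nonneg (S u ω) hi
      push_cast
      set N : ℝ := (pulls S u ω i : ℝ)
      have hN : 0 ≤ N := Nat.cast_nonneg _
      have hb : B ≤ B * Real.sqrt (α * Real.log T) := le_mul_of_one_le_right hB hα
      set b := B * Real.sqrt (α * Real.log T)
      have s1 : Real.sqrt N ≤ Real.sqrt (N + 1) := Real.sqrt_le_sqrt (by linarith)
      have s2 : 1 ≤ Real.sqrt (N + 1) := Real.one_le_sqrt.2 (by linarith)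
      have hb0 : 0 ≤ b := hB.trans hb
      have := mul_le_mul_of_nonneg_left s1 hb0
      have := mul_le_mul_of_nonneg_left s2 hb0
      nlinarith
    · rw [pulls_succ_of_notMem S ω hi, cumMean_succ_of_notMem M S ω hi]
      exact ih (by omega) fun s hs => h s (by omega)

end Pathwise

/-! ### Regret in windows and its combination over the stages -/

section Window

variable {n k : ℕ} {Ω : Type*} {B : ℝ}
  {M : RewardModel n k B} {α : ℝ} {T : ℕ} {S : ℕ → Ω → KSet n k}
  {X : ℕ → Ω → Fin n → ℝ} {ω : Ω}

open Classical in
/-- The times before `u` at which the selected set is not `sstar`. -/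
noncomputable def subTimes (S : ℕ → Ω → KSet n k) (ω : Ω) (sstar : KSet n k) (u : ℕ) : Finset ℕ :=
  (Finset.range u).filter (fun c => S c ω ≠ sstar)

open Classical in
theorem sum_filter_mem_eq (M : RewardModel n k B) (D : Finset ℕ) :
    ∑ c ∈ D, M.setMean (S c ω) =
      ∑ i, ∑ c ∈ D.filter (fun c => i ∈ (S c ω).1), M.armMean (S c ω) i := by
  simp_rw [M.setMean_eq_sum]
  exact Finset.sum_comm' (by simp [and_comm])

open Classical in
theorem sum_card_filter_mem (D : Finset ℕ) :
    ∑ i, ((D.filter (fun c => i ∈ (S c ω).1)).card : ℝ) = k * D.card := by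
  have : ∀ i, ((D.filter (fun c => i ∈ (S c ω).1)).card : ℝ) =
      ∑ c ∈ D.filter (fun c => i ∈ (S c ω).1), (1 : ℝ) := by intro i; simp
  simp_rw [this]
  rw [← Finset.sum_comm' (s := D) (t := fun c => (S c ω).1) (by simp [and_comm])]
  simp [(S _ ω).2, mul_comm]

theorem sum_sqrt_le_sqrt {ι : Type*} [Fintype ι] (N : ι → ℝ) (hN : ∀ i, 0 ≤ N i) :
    ∑ i, Real.sqrt (N i) ≤ Real.sqrt (Fintype.card ι * ∑ i, N i) := by
  apply Real.le_sqrt_of_sq_le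
  refine (sq_sum_le_card_mul_sum_sq (s := Finset.univ) (f := fun i => Real.sqrt (N i))).trans ?_
  simp [Real.sq_sqrt (hN _)]

/-- In terms of `x = √N` the expression is `x * (g * x - b)`: nonpositive at first, then increasing.
This allows a count to be lowered. -/
theorem mul_sub_sqrt_le_of_le {g b N N' e : ℝ} (hg : 0 ≤ g) (hN : 0 ≤ N)
    (hNN : N ≤ N') (he : 0 ≤ e) (h : g * N' - b * Real.sqrt N' ≤ e) :
    g * N - b * Real.sqrt N ≤ e := by
  have h1 : g * N - b * Real.sqrt N = Real.sqrt N * (g * Real.sqrt N - b) := by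
    nlinarith [Real.mul_self_sqrt hN]
  have h2 : g * N' - b * Real.sqrt N' = Real.sqrt N' * (g * Real.sqrt N' - b) := by
    nlinarith [Real.mul_self_sqrt (hN.trans hNN)]
  have hs := Real.sqrt_le_sqrt hNN
  have h0 := Real.sqrt_nonneg N
  by_cases hneg : g * Real.sqrt N - b ≤ 0
  · rw [h1]; exact (mul_nonpos_of_nonneg_of_nonpos h0 hneg).trans he
  · refine le_trans ?_ h
    rw [h1, h2]
    have := mul_le_mul_of_nonneg_left hs hg
    exact mul_le_mul hs (by linarith) (by linarith) (h0.trans hs)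

open Classical in
-- Makes the width depend on the suboptimal rounds alone, as the gap bound needs. Rounds with
-- `sstar` contribute no excess over `M.armMean sstar i` when `i` is optimal, and do not involve `i`
-- otherwise.
theorem mul_card_le_sum_armMean (hg : Concentrated M α T S X ω) (hB : 0 ≤ B)
    (hα : 1 ≤ Real.sqrt (α * Real.log T)) {sstar : KSet n k}
    (hc : M.WeakOptimalSetConsistency sstar) {u : ℕ} (hu : u ≤ T) {θ : ℝ} (hθ : θ ≤ B)
    {i : Fin n} (hi : i ∈ sstar.1 → M.armMean sstar i ≤ θ)
    (h : ∀ s < u, i ∈ (S s ω).1 → (θ : EReal) ≤ ucb B α T S X s ω i) :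
    θ * ((subTimes S ω sstar u).filter (fun c => i ∈ (S c ω).1)).card -
      3 * (B * Real.sqrt (α * Real.log T)) *
        Real.sqrt ((subTimes S ω sstar u).filter (fun c => i ∈ (S c ω).1)).card ≤
      ∑ c ∈ (subTimes S ω sstar u).filter (fun c => i ∈ (S c ω).1), M.armMean (S c ω) i := by
  have hmain := mul_pulls_le_cumMean hg hB hα hu hθ h
  set P := (Finset.range u).filter (fun c => i ∈ (S c ω).1) with hP
  have hD : (subTimes S ω sstar u).filter (fun c => i ∈ (S c ω).1) =
      P.filter (fun c => S c ω ≠ sstar) := by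
    rw [hP, subTimes, Finset.filter_comm]
  rw [hD]
  have hpull : pulls S u ω i = P.card := rfl
  have hcum : cumMean M S u ω i = ∑ c ∈ P, M.armMean (S c ω) i := rfl
  rw [hpull, hcum] at hmain
  by_cases his : i ∈ sstar.1
  · have hsplit := Finset.sum_filter_add_sum_filter_not P (fun c => S c ω ≠ sstar)
      (fun c => M.armMean (S c ω) i - M.armMean sstar i)
    have hz : ∑ c ∈ P.filter (fun c => ¬ (S c ω ≠ sstar)),
        (M.armMean (S c ω) i - M.armMean sstar i) = 0 := by
      apply Finset.sum_eq_zero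
      intro c hc'
      have := (Finset.mem_filter.1 hc').2
      push Not at this
      rw [this, sub_self]
    have he : 0 ≤ ∑ c ∈ P.filter (fun c => S c ω ≠ sstar),
        (M.armMean (S c ω) i - M.armMean sstar i) := by
      apply Finset.sum_nonneg
      intro c hc'
      have := (Finset.mem_filter.1 (Finset.mem_filter.1 hc').1).2
      exact sub_nonneg.2 (M.armMean_le_of_consistent hc this his)
    have hle : ((P.filter (fun c => S c ω ≠ sstar)).card : ℝ) ≤ P.card := by
      exact_mod_cast Finset.card_filter_le _ _
    rw [hz, add_zero] at hsplit
    have := mul_sub_sqrt_le_of_le (g := θ - M.armMean sstar i)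
      (b := 3 * (B * Real.sqrt (α * Real.log T))) (sub_nonneg.2 (hi his))
      (Nat.cast_nonneg _) hle he ?_
    · rw [Finset.sum_sub_distrib, Finset.sum_const, nsmul_eq_mul] at this
      linarith
    · rw [hsplit, Finset.sum_sub_distrib, Finset.sum_const, nsmul_eq_mul]
      linarith
  · have : P.filter (fun c => S c ω ≠ sstar) = P := by
      apply Finset.filter_true_of_mem
      intro c hc' heq
      have := (Finset.mem_filter.1 hc').2
      rw [heq] at this
      exact his this
    rw [this]
    exact hmain

open Classical in
/-- The regret of a window in which every selected arm has an upper confidence bound of at least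
`θ`, where `A` contains the optimal arms with a mean above `θ`. -/
theorem window_regret_le (hg : Concentrated M α T S X ω) (hB : 0 ≤ B)
    (hα : 1 ≤ Real.sqrt (α * Real.log T)) {sstar : KSet n k}
    (hc : M.WeakOptimalSetConsistency sstar) {u : ℕ} (hu : u ≤ T) {θ : ℝ} (hθ : θ ≤ B)
    {A : Finset (Fin n)} (hA : A ⊆ sstar.1)
    (hA' : ∀ l ∈ sstar.1, l ∉ A → M.armMean sstar l ≤ θ)
    (h : ∀ s < u, ∀ i ∈ (S s ω).1, (θ : EReal) ≤ ucb B α T S X s ω i) :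
    ∑ c ∈ subTimes S ω sstar u, (M.setMean sstar - M.setMean (S c ω)) +
        (subTimes S ω sstar u).card * ∑ l ∈ sstar.1 \ A, (θ - M.armMean sstar l) ≤
      3 * (B * Real.sqrt (α * Real.log T)) * Real.sqrt (n * (k * (subTimes S ω sstar u).card)) +
        ∑ l ∈ A, ((subTimes S ω sstar u).filter (fun c => l ∉ (S c ω).1)).card *
          (M.armMean sstar l - θ) := by
  set D := subTimes S ω sstar u with hD
  set b := B * Real.sqrt (α * Real.log T) with hb
  have hb0 : 0 ≤ b := by positivity
  set N : Fin n → ℝ := fun i => ((D.filter (fun c => i ∈ (S c ω).1)).card : ℝ) with hN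
  have hNsum : ∑ i, N i = k * D.card := sum_card_filter_mem D
  have hsq : ∑ i, Real.sqrt (N i) ≤ Real.sqrt (n * (k * D.card)) := by
    have := sum_sqrt_le_sqrt N (fun i => Nat.cast_nonneg _)
    rwa [hNsum, Fintype.card_fin] at this
  set F : Fin n → ℝ := fun i => ∑ c ∈ D.filter (fun c => i ∈ (S c ω).1), M.armMean (S c ω) i
    with hF
  have hFsum : ∑ c ∈ D, M.setMean (S c ω) = ∑ i, F i := sum_filter_mem_eq M D
  -- Arms of `A` are credited with their full optimal mean, by consistency; all others with `θ` per
  -- pull less the width.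
  have hlow : ∀ i, θ * N i - 3 * b * Real.sqrt (N i) +
      (if i ∈ A then (M.armMean sstar i - θ) * N i else 0) ≤ F i := by
    intro i
    split_ifs with hiA
    · have h1 : N i * M.armMean sstar i ≤ F i := by
        simp only [hN, hF]
        rw [← nsmul_eq_mul]
        apply Finset.card_nsmul_le_sum
        intro c hc'
        exact M.armMean_le_of_consistent hc (Finset.mem_filter.1 hc').2 (hA hiA)
      have : 0 ≤ 3 * b * Real.sqrt (N i) := by positivity
      nlinarith
    · rw [add_zero]
      exact mul_card_le_sum_armMean hg hB hα hc hu hθ (fun his => hA' i his hiA)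
        (fun s hs hi => h s hs i hi)
  have hsum := Finset.sum_le_sum (fun i (_ : i ∈ Finset.univ) => hlow i)
  rw [Finset.sum_add_distrib, Finset.sum_sub_distrib, ← Finset.mul_sum, ← Finset.mul_sum,
    Finset.sum_ite_mem, Finset.univ_inter, hNsum] at hsum
  have hMN : ∀ l ∈ A, ((D.filter (fun c => l ∉ (S c ω).1)).card : ℝ) = D.card - N l := by
    intro l _
    have := Finset.card_filter_add_card_filter_not (s := D) (fun c => l ∈ (S c ω).1)
    simp only [hN]
    rw [← this]; push_cast; ring
  have hMsum : ∑ l ∈ A, ((D.filter (fun c => l ∉ (S c ω).1)).card : ℝ) *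
      (M.armMean sstar l - θ) = ∑ l ∈ A, (D.card - N l) * (M.armMean sstar l - θ) :=
    Finset.sum_congr rfl fun l hl => by rw [hMN l hl]
  rw [hMsum]
  have h1 : ∑ l ∈ sstar.1 \ A, (θ - M.armMean sstar l) =
      k * θ - M.setMean sstar + ∑ l ∈ A, (M.armMean sstar l - θ) := by
    have h2 := Finset.sum_sdiff (f := fun l => θ - M.armMean sstar l) hA
    have h3 : ∑ l ∈ sstar.1, (θ - M.armMean sstar l) = k * θ - M.setMean sstar := by
      rw [M.setMean_eq_sum, Finset.sum_sub_distrib, Finset.sum_const, sstar.2, nsmul_eq_mul]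
    have h4 : ∑ l ∈ A, (M.armMean sstar l - θ) = - ∑ l ∈ A, (θ - M.armMean sstar l) := by
      rw [← Finset.sum_neg_distrib]; exact Finset.sum_congr rfl fun _ _ => by ring
    linarith
  have h5 : ∑ l ∈ A, (D.card - N l) * (M.armMean sstar l - θ) =
      D.card * ∑ l ∈ A, (M.armMean sstar l - θ) - ∑ l ∈ A, (M.armMean sstar l - θ) * N l := by
    rw [Finset.mul_sum, ← Finset.sum_sub_distrib]
    exact Finset.sum_congr rfl fun _ _ => by ring
  rw [h1, h5, Finset.sum_sub_distrib, hFsum, Finset.sum_const, nsmul_eq_mul]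
  have := mul_le_mul_of_nonneg_left hsq (show 0 ≤ 3 * b by positivity)
  nlinarith

open Classical in
/-- The regret of a path is at most a sum of `k` terms, each of which is the excess of a confidence
term over the regret of an initial segment of the path. -/
theorem exists_path_regret_le (hg : Concentrated M α T S X ω) (hB : 0 ≤ B)
    (hα : 1 ≤ Real.sqrt (α * Real.log T)) {m : ℕ} (hm : k = m + 1) {sstar : KSet n k}
    (hc : M.WeakOptimalSetConsistency sstar)
    (htop : ∀ t < T, ∀ i ∈ (S t ω).1, ∀ j ∉ (S t ω).1,
      ucb B α T S X t ω j ≤ ucb B α T S X t ω i) :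
    ∃ u : ℕ → ℕ, (∀ a, u a ≤ T) ∧
      ∑ t ∈ Finset.range T, (M.setMean sstar - M.setMean (S t ω)) =
        ∑ c ∈ subTimes S ω sstar (u m), (M.setMean sstar - M.setMean (S c ω)) ∧
      ∑ t ∈ Finset.range T, (M.setMean sstar - M.setMean (S t ω)) ≤
        3 * (B * Real.sqrt (α * Real.log T)) *
            Real.sqrt (n * (k * (subTimes S ω sstar (u m)).card)) +
          ∑ a ∈ Finset.range m, (3 * (B * Real.sqrt (α * Real.log T)) *
            Real.sqrt (n * (k * (subTimes S ω sstar (u a)).card)) -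
            ∑ c ∈ subTimes S ω sstar (u a), (M.setMean sstar - M.setMean (S c ω))) := by
  obtain ⟨i0, hi0⟩ := Finset.card_pos.1 (show 0 < sstar.1.card by rw [sstar.2]; omega)
  have : Inhabited (Fin n) := ⟨i0⟩
  obtain ⟨p, hp1, hp2, hp3⟩ := exists_antitone_enumeration (M.armMean sstar) k sstar.1 sstar.2
  have hpmem : ∀ a < k, p a ∈ sstar.1 := fun a ha => by
    rw [← hp2]; exact Finset.mem_image_of_mem _ (Finset.mem_range.2 ha)
  -- From time `u a` on, the `a + 1` best optimal arms are always selected.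
  choose u hu1 hu2 hu3 using fun a => exists_last_time (fun t => ∃ l ≤ a, p l ∉ (S t ω).1) T
  set ν : ℕ → ℝ := fun l => M.armMean sstar (p l) with hν
  set e : ℕ → ℝ := fun a => 3 * (B * Real.sqrt (α * Real.log T)) *
            Real.sqrt (n * (k * (subTimes S ω sstar (u a)).card)) with he
  set ρ : ℕ → ℝ := fun a =>
    ∑ c ∈ subTimes S ω sstar (u a), (M.setMean sstar - M.setMean (S c ω)) with hρ
  set c : ℕ → ℝ := fun a => ((subTimes S ω sstar (u a)).card : ℝ) with hcdef
  have step : ∀ a < k, ρ a + c a * ∑ l ∈ Finset.Ico (a + 1) k, (ν a - ν l) ≤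
      e a + ∑ l ∈ Finset.range a, c l * (ν l - ν a) := by
    intro a ha
    have hinj : Set.InjOn p (Finset.range a) := hp1.mono (by
      intro x hx; simp only [Finset.coe_range, Set.mem_Iio] at hx ⊢; omega)
    have hinj2 : Set.InjOn p (Finset.Ico a k) := hp1.mono (by
      intro x hx
      simp only [Finset.coe_range, Set.mem_Iio, Finset.coe_Ico, Set.mem_Ico] at hx ⊢; omega)
    have hsd : sstar.1 \ (Finset.range a).image p = (Finset.Ico a k).image p := by
      rw [← hp2]
      ext x
      simp only [Finset.mem_sdiff, Finset.mem_image, Finset.mem_range, Finset.mem_Ico]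
      constructor
      · rintro ⟨⟨l, hl, rfl⟩, h2⟩
        exact ⟨l, ⟨by by_contra hlt; exact h2 ⟨l, by omega, rfl⟩, hl⟩, rfl⟩
      · rintro ⟨l, ⟨hl1, hl2⟩, rfl⟩
        refine ⟨⟨l, hl2, rfl⟩, ?_⟩
        rintro ⟨l', hl', heq⟩
        have := hp1 (by simp; omega) (by simp; omega) heq
        omega
    have hw := window_regret_le hg hB hα hc (hu1 a) (θ := ν a)
      (M.armMean_le sstar (hpmem a ha)) (A := (Finset.range a).image p) ?_ ?_ ?_
    · rw [hsd, Finset.sum_image hinj2, Finset.sum_image hinj,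
        Finset.sum_eq_sum_Ico_succ_bot ha, sub_self, zero_add] at hw
      refine hw.trans ?_
      gcongr with l hl
      · exact sub_nonneg.2 (hp3 l a (Finset.mem_range.1 hl).le ha)
      -- A round that misses `p l` lies before `u l` and is suboptimal, so it is counted in `c l`.
      · simp only [hcdef]
        norm_cast
        apply Finset.card_le_card
        intro t ht
        simp only [subTimes, Finset.mem_filter, Finset.mem_range] at ht ⊢
        exact ⟨hu3 l t (ht.1.1.trans_le (hu1 a)) ⟨l, le_rfl, ht.2⟩, ht.1.2⟩
    · intro x hx
      obtain ⟨l, hl, rfl⟩ := Finset.mem_image.1 hx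
      exact hpmem l ((Finset.mem_range.1 hl).trans ha)
    · intro l hl hl'
      have : l ∈ sstar.1 \ (Finset.range a).image p := Finset.mem_sdiff.2 ⟨hl, hl'⟩
      rw [hsd] at this
      obtain ⟨b, hb, rfl⟩ := Finset.mem_image.1 this
      rw [Finset.mem_Ico] at hb
      exact hp3 a b hb.1 hb.2
    -- At `t = u a - 1` some `p l` with `l ≤ a` is unselected although its UCB is at least `ν l ≥ ν
    -- a`; this bounds the UCB of every arm selected up to `t` from below.
    · intro s hs i hi
      rcases hu2 a with h0 | ⟨t, ht, l, hl, hlt⟩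
      · omega
      · have htT : t < T := by have := hu1 a; omega
        have h1 := ucb_le_ucb_of_notMem α T S X ω htop (show s ≤ t by omega) htT hi _ hlt
        have h2 := armMean_le_ucb hc hg htT (hpmem l (by omega))
        refine le_trans ?_ (h2.trans h1)
        rw [EReal.coe_le_coe_iff]
        exact hp3 l a hl ha
  -- After `u m` all `k` optimal arms are selected, so the set is `sstar` and adds no regret.
  have htot : ∑ t ∈ Finset.range T, (M.setMean sstar - M.setMean (S t ω)) = ρ m := by
    symm
    apply Finset.sum_subset
    · intro t ht
      simp only [subTimes, Finset.mem_filter, Finset.mem_range] at ht ⊢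
      exact ht.1.trans_le (hu1 m)
    · intro t ht ht'
      simp only [subTimes, Finset.mem_filter, Finset.mem_range, not_and, not_not] at ht ht'
      have : S t ω = sstar := by
        by_cases htu : t < u m
        · exact ht' htu
        · have hsub : sstar.1 ⊆ (S t ω).1 := by
            intro x hx
            rw [← hp2] at hx
            obtain ⟨l, hl, rfl⟩ := Finset.mem_image.1 hx
            by_contra hnot
            exact htu (hu3 m t ht ⟨l, by have := Finset.mem_range.1 hl; omega, hnot⟩)
          exact Subtype.ext (Finset.eq_of_subset_of_card_le hsub
            (by rw [sstar.2, (S t ω).2])).symm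
      rw [this, sub_self]
  refine ⟨u, hu1, htot, ?_⟩
  rw [htot]
  have hfin := step m (by omega)
  have hrec := sum_mul_sub_le_sum (k := m) ν c (fun a => e a - ρ a) (by
    intro a ha
    have := step a (by omega)
    rw [hm] at this
    linarith)
  rw [hm] at hfin
  simp only [Finset.Ico_self, Finset.sum_empty, mul_zero, add_zero] at hfin
  linarith

/-- The regret of a path, without an assumption on the gap. -/
theorem path_regret_le_sqrt (hg : Concentrated M α T S X ω) (hB : 0 ≤ B)
    (hα : 1 ≤ Real.sqrt (α * Real.log T)) (hk : 0 < k) {sstar : KSet n k}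
    (hopt : M.IsOptimalSet sstar) (hc : M.WeakOptimalSetConsistency sstar)
    (htop : ∀ t < T, ∀ i ∈ (S t ω).1, ∀ j ∉ (S t ω).1,
      ucb B α T S X t ω j ≤ ucb B α T S X t ω i) :
    ∑ t ∈ Finset.range T, (M.setMean sstar - M.setMean (S t ω)) ≤
      k * (3 * (B * Real.sqrt (α * Real.log T)) * Real.sqrt (n * (k * T))) := by
  obtain ⟨m, hm⟩ : ∃ m, k = m + 1 := ⟨k - 1, by omega⟩
  obtain ⟨u, hu, -, h⟩ := exists_path_regret_le hg hB hα hm hc htop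
  have hcard : ∀ a, ((subTimes S ω sstar (u a)).card : ℝ) ≤ T := by
    intro a
    have : (subTimes S ω sstar (u a)).card ≤ u a := by
      simpa [subTimes] using Finset.card_filter_le (Finset.range (u a)) _
    exact_mod_cast this.trans (hu a)
  have hE : ∀ a, 3 * (B * Real.sqrt (α * Real.log T)) *
      Real.sqrt (n * (k * (subTimes S ω sstar (u a)).card)) ≤
      3 * (B * Real.sqrt (α * Real.log T)) * Real.sqrt (n * (k * T)) := by
    intro a
    have := hcard a
    gcongr
  refine h.trans ?_
  have h2 : ∑ a ∈ Finset.range m, (3 * (B * Real.sqrt (α * Real.log T)) *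
            Real.sqrt (n * (k * (subTimes S ω sstar (u a)).card)) -
            ∑ c ∈ subTimes S ω sstar (u a), (M.setMean sstar - M.setMean (S c ω))) ≤
      ∑ a ∈ Finset.range m, 3 * (B * Real.sqrt (α * Real.log T)) * Real.sqrt (n * (k * T)) := by
    apply Finset.sum_le_sum
    intro a _
    have : 0 ≤ ∑ c ∈ subTimes S ω sstar (u a), (M.setMean sstar - M.setMean (S c ω)) :=
      Finset.sum_nonneg fun c _ => sub_nonneg.2 (hopt _)
    linarith [hE a]
  rw [Finset.sum_const, Finset.card_range, nsmul_eq_mul] at h2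
  have hk' : (k : ℝ) = m + 1 := by rw [hm]; push_cast; ring
  have := hE m
  calc _ ≤ _ := add_le_add this h2
    _ = ((m : ℝ) + 1) * (3 * (B * Real.sqrt (α * Real.log T)) * Real.sqrt (n * (k * T))) := by ring
    _ = _ := by rw [← hk']

/-- The regret of a path if every set but `sstar` has a gap of at least `ε`. -/
theorem path_regret_le_gap (hg : Concentrated M α T S X ω) (hB : 0 ≤ B)
    (hα : 1 ≤ Real.sqrt (α * Real.log T)) (hk : 0 < k) {sstar : KSet n k}
    (hc : M.WeakOptimalSetConsistency sstar)
    (htop : ∀ t < T, ∀ i ∈ (S t ω).1, ∀ j ∉ (S t ω).1,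
      ucb B α T S X t ω j ≤ ucb B α T S X t ω i)
    {ε : ℝ} (hε : 0 < ε) (hgap : ∀ s, s ≠ sstar → ε ≤ M.setMean sstar - M.setMean s) :
    ∑ t ∈ Finset.range T, (M.setMean sstar - M.setMean (S t ω)) ≤
      k * ((3 * (B * Real.sqrt (α * Real.log T))) ^ 2 * (n * k) / ε) := by
  obtain ⟨m, hm⟩ : ∃ m, k = m + 1 := ⟨k - 1, by omega⟩
  obtain ⟨u, -, htot, h⟩ := exists_path_regret_le hg hB hα hm hc htop
  set b := 3 * (B * Real.sqrt (α * Real.log T)) with hb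
  have hρ : ∀ a, ε * (subTimes S ω sstar (u a)).card ≤
      ∑ c ∈ subTimes S ω sstar (u a), (M.setMean sstar - M.setMean (S c ω)) := by
    intro a
    rw [mul_comm, ← nsmul_eq_mul]
    apply Finset.card_nsmul_le_sum
    intro c hc'
    exact hgap _ (Finset.mem_filter.1 hc').2
  -- Maximum over `√N` of a quadratic, by completing the square.
  have hq : ∀ (r : ℝ) (N : ℕ), 0 < r → b * Real.sqrt (n * (k * N)) - r * N ≤
      b ^ 2 * (n * k) / (4 * r) := by
    intro r N hr
    rw [← mul_assoc, Real.sqrt_mul (by positivity), le_div_iff₀ (by positivity)]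
    have h1 := Real.sq_sqrt (show (0 : ℝ) ≤ n * k by positivity)
    have h2 := Real.sq_sqrt (show (0 : ℝ) ≤ N by positivity)
    have h3 := sq_nonneg (b * Real.sqrt (n * k) - 2 * r * Real.sqrt N)
    have h4 : b ^ 2 * (n * k) = b ^ 2 * Real.sqrt (n * k) ^ 2 := by rw [h1]
    have h5 : r * N * (4 * r) = 4 * r ^ 2 * Real.sqrt N ^ 2 := by rw [h2]; ring
    rw [h4, sub_mul, h5]
    linarith
  have h2 : ∑ a ∈ Finset.range m, (b * Real.sqrt (n * (k * (subTimes S ω sstar (u a)).card)) -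
            ∑ c ∈ subTimes S ω sstar (u a), (M.setMean sstar - M.setMean (S c ω))) ≤
      ∑ a ∈ Finset.range m, b ^ 2 * (n * k) / (4 * ε) := by
    apply Finset.sum_le_sum
    intro a _
    linarith [hρ a, hq ε (subTimes S ω sstar (u a)).card hε]
  rw [Finset.sum_const, Finset.card_range, nsmul_eq_mul] at h2
  -- The last stage has no subtracted regret; half of the total regret is moved over from the
  -- left-hand side, hence `ε / 2`.
  have h3 := hq (ε / 2) (subTimes S ω sstar (u m)).card (by positivity)
  have h4 := hρ m
  rw [← htot] at h4
  have hk' : (k : ℝ) = m + 1 := by rw [hm]; push_cast; ring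
  have e1 : b ^ 2 * (n * k) / (4 * ε) = b ^ 2 * (n * k) / ε / 4 := by field_simp
  have e2 : b ^ 2 * (n * k) / (4 * (ε / 2)) = b ^ 2 * (n * k) / ε / 2 := by field_simp; norm_num
  rw [e1] at h2
  rw [e2] at h3
  have hV : 0 ≤ b ^ 2 * (n * k) / ε := by positivity
  set V := b ^ 2 * (n * k) / ε
  rw [hk']
  have hm0 : (0 : ℝ) ≤ m := Nat.cast_nonneg m
  nlinarith [mul_nonneg hm0 hV]

end Window

/-! ### Concentration by exponential supermartingales -/

section Probability

variable {n k : ℕ} {B : ℝ}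

/-- Hoeffding's lemma for a variable in an interval of length `B`. -/
theorem RewardModel.lintegral_exp_le (M : RewardModel n k B) (s : KSet n k) {i : Fin n}
    (hi : i ∈ s.1) (lam : ℝ) :
    ∫⁻ x, ENNReal.ofReal (Real.exp (lam * (x i - M.armMean s i) - lam ^ 2 * B ^ 2 / 8)) ∂(M.law s)
      ≤ 1 := by
  have := M.isProb s
  have h := hasSubgaussianMGF_of_mem_Icc (μ := M.law s) (measurable_pi_apply i).aemeasurable
    (M.bounded s i hi)
  have hint : Integrable
      (fun x : Fin n → ℝ =>
        Real.exp (lam * (x i - M.armMean s i) - lam ^ 2 * B ^ 2 / 8)) (M.law s) := by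
    simp_rw [Real.exp_sub]
    exact (h.integrable_exp_mul lam).div_const _
  rw [← ofReal_integral_eq_lintegral_ofReal hint (Filter.Eventually.of_forall fun _ =>
    (Real.exp_pos _).le), ENNReal.ofReal_le_one]
  simp_rw [Real.exp_sub]
  rw [integral_div, div_le_one (Real.exp_pos _)]
  refine (h.mgf_le lam).trans (Real.exp_le_exp.2 (le_of_eq ?_))
  have : (((‖B - 0‖₊ / 2) ^ 2 : NNReal) : ℝ) = B ^ 2 / 4 := by
    push_cast
    rw [sub_zero, Real.norm_eq_abs, div_pow, sq_abs]; norm_num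
  rw [this]; ring

variable {Ω : Type*}

/-- The exponential process of the deviation of the rewards of arm `i` from their expectations. -/
noncomputable def expDeviation (M : RewardModel n k B) (S : ℕ → Ω → KSet n k)
    (X : ℕ → Ω → Fin n → ℝ) (lam : ℝ) (t : ℕ) (i : Fin n) (ω : Ω) : ℝ :=
  Real.exp (lam * (cumReward S X t ω i - cumMean M S t ω i) -
    lam ^ 2 * B ^ 2 / 8 * pulls S t ω i)

namespace IsUCBRun

variable {M : RewardModel n k B} {α : ℝ} {T : ℕ} {mΩ : MeasurableSpace Ω} {P : Measure Ω}
  {ℱ : Filtration ℕ mΩ} {S : ℕ → Ω → KSet n k} {X : ℕ → Ω → Fin n → ℝ}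

theorem measurable_select (h : IsUCBRun M α T P ℱ S X) {t : ℕ} (ht : t < T) :
    @Measurable Ω (KSet n k) (ℱ t) ⊤ (S t) := by
  let _ : MeasurableSpace (KSet n k) := ⊤
  let _ : MeasurableSpace Ω := ℱ t
  exact measurable_to_countable' fun s => h.measurable_S t ht s

theorem measurableSet_mem (h : IsUCBRun M α T P ℱ S X) {t : ℕ} (ht : t < T) (i : Fin n) :
    MeasurableSet[ℱ t] {ω | i ∈ (S t ω).1} :=
  show MeasurableSet[ℱ t] (S t ⁻¹' {s : KSet n k | i ∈ s.1}) from h.measurable_select ht trivial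

theorem measurable_comp_select (h : IsUCBRun M α T P ℱ S X) {t : ℕ} (ht : t < T)
    (f : KSet n k → ℝ) : Measurable[ℱ t] fun ω => f (S t ω) :=
  fun A _ => show MeasurableSet[ℱ t] (S t ⁻¹' (f ⁻¹' A)) from h.measurable_select ht trivial

theorem measurableSet_select (h : IsUCBRun M α T P ℱ S X) {t : ℕ} (ht : t < T) (s : KSet n k) :
    MeasurableSet {ω | S t ω = s} :=
  ℱ.le t _ (h.measurable_S t ht s)

theorem measurable_reward (h : IsUCBRun M α T P ℱ S X) {t : ℕ} (ht : t < T) : Measurable (X t) :=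
  (h.measurable_X t ht).mono (ℱ.le (t + 1)) le_rfl

theorem measurable_cumReward (h : IsUCBRun M α T P ℱ S X) {t : ℕ} (ht : t ≤ T) (i : Fin n) :
    Measurable[ℱ t] fun ω => cumReward S X t ω i := by
  induction t with
  | zero => simp only [cumReward, Finset.range_zero, Finset.filter_empty, Finset.sum_empty]
            exact measurable_const
  | succ t ih =>
    have ih := (ih (by omega)).mono (ℱ.mono (Nat.le_succ t)) le_rfl
    have hm := ℱ.mono (Nat.le_succ t) _ (h.measurableSet_mem (show t < T by omega) i)
    have hX := (measurable_pi_apply i).comp (h.measurable_X t (by omega))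
    have : (fun ω => cumReward S X (t + 1) ω i) = fun ω =>
        if i ∈ (S t ω).1 then X t ω i + cumReward S X t ω i else cumReward S X t ω i := by
      funext ω
      split_ifs with hi
      · exact cumReward_succ_of_mem S X ω hi
      · exact cumReward_succ_of_notMem S X ω hi
    rw [this]
    let _ : MeasurableSpace Ω := ℱ (t + 1)
    exact Measurable.ite hm (hX.add ih) ih

theorem measurable_cumMean (h : IsUCBRun M α T P ℱ S X) {t : ℕ} (ht : t ≤ T) (i : Fin n) :
    Measurable[ℱ t] fun ω => cumMean M S t ω i := by
  induction t with
  | zero => simp only [cumMean, Finset.range_zero, Finset.filter_empty, Finset.sum_empty]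
            exact measurable_const
  | succ t ih =>
    have ih := (ih (by omega)).mono (ℱ.mono (Nat.le_succ t)) le_rfl
    have hm := ℱ.mono (Nat.le_succ t) _ (h.measurableSet_mem (show t < T by omega) i)
    have hX := (h.measurable_comp_select (show t < T by omega) fun s => M.armMean s i).mono
      (ℱ.mono (Nat.le_succ t)) le_rfl
    have : (fun ω => cumMean M S (t + 1) ω i) = fun ω =>
        if i ∈ (S t ω).1 then M.armMean (S t ω) i + cumMean M S t ω i else cumMean M S t ω i := by
      funext ω
      split_ifs with hi
      · exact cumMean_succ_of_mem M S ω hi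
      · exact cumMean_succ_of_notMem M S ω hi
    rw [this]
    let _ : MeasurableSpace Ω := ℱ (t + 1)
    exact Measurable.ite hm (hX.add ih) ih

theorem measurable_pulls (h : IsUCBRun M α T P ℱ S X) {t : ℕ} (ht : t ≤ T) (i : Fin n) :
    Measurable[ℱ t] fun ω => (pulls S t ω i : ℝ) := by
  induction t with
  | zero => simp only [pulls, Finset.range_zero, Finset.filter_empty, Finset.card_empty]
            exact measurable_const
  | succ t ih =>
    have ih := (ih (by omega)).mono (ℱ.mono (Nat.le_succ t)) le_rfl
    have hm := ℱ.mono (Nat.le_succ t) _ (h.measurableSet_mem (show t < T by omega) i)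
    have : (fun ω => (pulls S (t + 1) ω i : ℝ)) = fun ω =>
        if i ∈ (S t ω).1 then (pulls S t ω i : ℝ) + 1 else (pulls S t ω i : ℝ) := by
      funext ω
      split_ifs with hi
      · rw [pulls_succ_of_mem S ω hi]; push_cast; rfl
      · rw [pulls_succ_of_notMem S ω hi]
    rw [this]
    let _ : MeasurableSpace Ω := ℱ (t + 1)
    exact Measurable.ite hm (ih.add measurable_const) ih

theorem measurable_expDeviation (h : IsUCBRun M α T P ℱ S X) (lam : ℝ) {t : ℕ} (ht : t ≤ T)
    (i : Fin n) : Measurable[ℱ t] fun ω => ENNReal.ofReal (expDeviation M S X lam t i ω) := by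
  have h1 := h.measurable_cumReward ht i
  have h2 := h.measurable_cumMean ht i
  have h3 := h.measurable_pulls ht i
  let _ : MeasurableSpace Ω := ℱ t
  unfold expDeviation
  exact (Real.measurable_exp.comp (((h1.sub h2).const_mul lam).sub
    (h3.const_mul (lam ^ 2 * B ^ 2 / 8)))).ennreal_ofReal

theorem map_restrict (h : IsUCBRun M α T P ℱ S X) {t : ℕ} (ht : t < T) (s : KSet n k) {A : Set Ω}
    (hA : MeasurableSet[ℱ t] A) :
    (P.restrict (A ∩ {ω | S t ω = s})).map (X t) = P (A ∩ {ω | S t ω = s}) • M.law s := by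
  ext E hE
  rw [Measure.map_apply (h.measurable_reward ht) hE,
    Measure.restrict_apply (h.measurable_reward ht hE), Measure.smul_apply, smul_eq_mul,
    Set.inter_comm]
  exact h.cond_law t ht s A hA E hE

/-- Given the past and the selected set, the reward vector is distributed as the model says. -/
theorem setLIntegral_mul (h : IsUCBRun M α T P ℱ S X) {t : ℕ} (ht : t < T) (s : KSet n k)
    {g : Ω → ENNReal} (hg : Measurable[ℱ t] g) {f : (Fin n → ℝ) → ENNReal} (hf : Measurable f) :
    ∫⁻ ω in {ω | S t ω = s}, f (X t ω) * g ω ∂P =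
      (∫⁻ x, f x ∂(M.law s)) * ∫⁻ ω in {ω | S t ω = s}, g ω ∂P := by
  have hX := h.measurable_reward ht
  set ν := P.restrict {ω | S t ω = s} with hν
  have hfX : Measurable (f ∘ X t) := hf.comp hX
  -- On the past σ-algebra, weighting by `f (X t)` only multiplies the measure by a constant;
  -- integrating the `ℱ t`-measurable `g` against both sides gives the claim.
  have key : (ν.withDensity (f ∘ X t)).trim (ℱ.le t) =
      (∫⁻ x, f x ∂(M.law s)) • ν.trim (ℱ.le t) := by
    refine @Measure.ext _ (ℱ t) _ _ fun A hA => ?_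
    have hA' := ℱ.le t A hA
    rw [trim_measurableSet_eq _ hA, withDensity_apply _ hA', Measure.smul_apply,
      trim_measurableSet_eq _ hA, hν, Measure.restrict_restrict hA', Measure.restrict_apply hA']
    have := lintegral_map (μ := P.restrict (A ∩ {ω | S t ω = s})) hf hX
    simp only [Function.comp_apply]
    rw [← this, h.map_restrict ht s hA, lintegral_smul_measure, smul_eq_mul, smul_eq_mul, mul_comm]
  have h1 := lintegral_withDensity_eq_lintegral_mul ν hfX (hg.mono (ℱ.le t) le_rfl)
  simp only [Pi.mul_apply, Function.comp_apply] at h1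
  rw [← h1, ← lintegral_trim (ℱ.le t) hg, key, lintegral_smul_measure, smul_eq_mul,
    lintegral_trim (ℱ.le t) hg]

theorem lintegral_eq_tsum (h : IsUCBRun M α T P ℱ S X) {t : ℕ} (ht : t < T) (f : Ω → ENNReal) :
    ∫⁻ ω, f ω ∂P = ∑' s : KSet n k, ∫⁻ ω in {ω | S t ω = s}, f ω ∂P := by
  rw [← lintegral_iUnion (fun s => h.measurableSet_select ht s)]
  · have : ⋃ s : KSet n k, {ω | S t ω = s} = Set.univ := by ext; simp
    rw [this, Measure.restrict_univ]
  · intro s s' hs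
    rw [Function.onFun, Set.disjoint_left]
    intro ω h1 h2
    exact hs (h1.symm.trans h2)

/-- Supermartingale step: given the past and `S t = s`, the process is multiplied by a factor of
mean at most `1` if `i ∈ s`, and is unchanged otherwise. -/
theorem lintegral_expDeviation_le (h : IsUCBRun M α T P ℱ S X) [IsProbabilityMeasure P] (lam : ℝ)
    {t : ℕ} (ht : t ≤ T) (i : Fin n) :
    ∫⁻ ω, ENNReal.ofReal (expDeviation M S X lam t i ω) ∂P ≤ 1 := by
  induction t with
  | zero => simp [expDeviation, cumReward, cumMean, pulls]
  | succ t ih =>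
    refine le_trans ?_ (ih (by omega))
    have ht' : t < T := by omega
    rw [h.lintegral_eq_tsum ht', h.lintegral_eq_tsum ht' fun ω =>
      ENNReal.ofReal (expDeviation M S X lam t i ω)]
    refine ENNReal.tsum_le_tsum fun s => ?_
    by_cases hi : i ∈ s.1
    · have hf : Measurable fun x : Fin n → ℝ =>
          ENNReal.ofReal (Real.exp (lam * (x i - M.armMean s i) - lam ^ 2 * B ^ 2 / 8)) := by
        fun_prop
      rw [setLIntegral_congr_fun (g := fun ω => ENNReal.ofReal
          (Real.exp (lam * (X t ω i - M.armMean s i) - lam ^ 2 * B ^ 2 / 8)) *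
            ENNReal.ofReal (expDeviation M S X lam t i ω)) (h.measurableSet_select ht' s),
        h.setLIntegral_mul ht' s (h.measurable_expDeviation lam ht'.le i) hf]
      · exact mul_le_of_le_one_left zero_le (M.lintegral_exp_le s hi lam)
      · intro ω hω
        have hω : S t ω = s := hω
        have hi' : i ∈ (S t ω).1 := hω ▸ hi
        simp only [expDeviation]
        rw [← ENNReal.ofReal_mul (Real.exp_pos _).le, ← Real.exp_add,
          cumReward_succ_of_mem S X ω hi', cumMean_succ_of_mem M S ω hi',
          pulls_succ_of_mem S ω hi', hω]
        congr 2
        push_cast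
        ring
    · refine le_of_eq (setLIntegral_congr_fun (h.measurableSet_select ht' s) ?_)
      intro ω hω
      have hω : S t ω = s := hω
      have hi' : i ∉ (S t ω).1 := hω ▸ hi
      simp only [expDeviation]
      rw [cumReward_succ_of_notMem S X ω hi', cumMean_succ_of_notMem M S ω hi',
          pulls_succ_of_notMem S ω hi']

theorem measureReal_expDeviation_ge (h : IsUCBRun M α T P ℱ S X) [IsProbabilityMeasure P] (lam : ℝ)
    {t : ℕ} (ht : t ≤ T) (i : Fin n) {r : ℝ} (hr : 0 < r) :
    P.real {ω | r ≤ expDeviation M S X lam t i ω} ≤ 1 / r := by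
  have h1 := mul_meas_ge_le_lintegral (μ := P)
    ((h.measurable_expDeviation lam ht i).mono (ℱ.le t) le_rfl) (ENNReal.ofReal r)
  have h2 := h1.trans (h.lintegral_expDeviation_le lam ht i)
  have h3 : {ω | ENNReal.ofReal r ≤ ENNReal.ofReal (expDeviation M S X lam t i ω)} =
      {ω | r ≤ expDeviation M S X lam t i ω} := by
    ext ω
    simp only [Set.mem_ofPred_eq]
    exact ENNReal.ofReal_le_ofReal_iff (Real.exp_pos _).le
  rw [h3] at h2
  have h4 := ENNReal.toReal_mono ENNReal.one_ne_top h2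
  rw [ENNReal.toReal_mul, ENNReal.toReal_ofReal hr.le, ENNReal.toReal_one] at h4
  rw [le_div_iff₀ hr, mul_comm]
  exact h4

end IsUCBRun

/-- An event that contains all failures of concentration: one of the exponential processes with
the parameter tuned to one of the possible numbers of pulls is large. -/
def deviationEvent (M : RewardModel n k B) (α : ℝ) (T : ℕ) (S : ℕ → Ω → KSet n k)
    (X : ℕ → Ω → Fin n → ℝ) : Set Ω :=
  ⋃ q ∈ (Finset.range T ×ˢ (Finset.univ : Finset (Fin n))) ×ˢ (Finset.range T ×ˢ
      ({1, -1} : Finset ℝ)),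
    {ω | (T : ℝ) ^ 4 ≤ expDeviation M S X
      (q.2.2 * (4 * Real.sqrt (α * Real.log T) / (B * Real.sqrt q.2.1))) q.1.1 q.1.2 ω}

theorem pulls_le (S : ℕ → Ω → KSet n k) (t : ℕ) (ω : Ω) (i : Fin n) : pulls S t ω i ≤ t := by
  unfold pulls
  simpa using Finset.card_filter_le (Finset.range t) (fun c => i ∈ (S c ω).1)

theorem concentrated_of_notMem_deviationEvent (M : RewardModel n k B) {α : ℝ} {T : ℕ}
    (hT : 2 ≤ T) (hα : 2 ≤ α) (hB : 0 < B) (S : ℕ → Ω → KSet n k)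
    (X : ℕ → Ω → Fin n → ℝ) {ω : Ω} (hω : ω ∉ deviationEvent M α T S X) :
    Concentrated M α T S X ω := by
  intro t ht i
  by_contra! hlt
  apply hω
  set N := pulls S t ω i with hN
  set Y := cumReward S X t ω i - cumMean M S t ω i with hY
  have hN0 : N ≠ 0 := by
    intro h0
    rw [h0] at hlt
    have : (Finset.range t).filter (fun c => i ∈ (S c ω).1) = ∅ := Finset.card_eq_zero.1 h0
    rw [hY, cumReward, cumMean, this] at hlt
    simp at hlt
  have hNpos : (0 : ℝ) < N := by positivity
  have hlog : 0 < Real.log T := Real.log_pos (by exact_mod_cast hT)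
  set a := Real.sqrt (α * Real.log T) with ha
  have ha2 : a ^ 2 = α * Real.log T := Real.sq_sqrt (by positivity)
  have ha0 : 0 ≤ a := Real.sqrt_nonneg _
  set r := Real.sqrt (N : ℝ) with hr
  have hr0 : 0 < r := Real.sqrt_pos.2 hNpos
  have hr2 : r ^ 2 = N := Real.sq_sqrt hNpos.le
  obtain ⟨σ, hσ, hσY⟩ : ∃ σ ∈ ({1, -1} : Finset ℝ), |Y| = σ * Y := by
    rcases abs_cases Y with h | h
    · exact ⟨1, by simp, by rw [h.1, one_mul]⟩
    · exact ⟨-1, by simp, by rw [h.1]; ring⟩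
  have hσ2 : σ ^ 2 = 1 := by
    rcases Finset.mem_insert.1 hσ with h | h
    · rw [h]; norm_num
    · rw [Finset.mem_singleton.1 h]; norm_num
  unfold deviationEvent
  simp only [Set.mem_iUnion]
  have hNT : N < T := (pulls_le S t ω i).trans_lt ht
  refine ⟨((t, i), (N, σ)), by
    simp only [Finset.mem_product, Finset.mem_range, Finset.mem_univ, and_true]
    exact ⟨ht, hNT, hσ⟩, ?_⟩
  simp only [Set.mem_ofPred_eq, expDeviation]
  rw [← hN, ← hY, ← hr]
  have hTpos : (0 : ℝ) < T := by positivity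
  have e0 : (T : ℝ) ^ 4 = Real.exp (4 * Real.log T) := by
    rw [show (4 : ℝ) * Real.log T = ((4 : ℕ) : ℝ) * Real.log T by norm_num, Real.exp_nat_mul,
      Real.exp_log hTpos]
  rw [e0, Real.exp_le_exp]
  -- With this parameter the linear term is at least `4a²` and the quadratic correction is `2a²`.
  -- What remains is `2a² = 2α log T ≥ 4 log T`, by `α ≥ 2`.
  have e1 : σ * (4 * a / (B * r)) * Y = 4 * a / (B * r) * |Y| := by rw [hσY]; ring
  have e2 : (σ * (4 * a / (B * r))) ^ 2 * B ^ 2 / 8 * N = 2 * a ^ 2 := by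
    rw [mul_pow, hσ2, ← hr2]; field_simp; ring
  have e3 : 4 * a / (B * r) * (B * a * r) = 4 * a ^ 2 := by field_simp
  have e4 : 4 * a / (B * r) * (B * a * r) ≤ 4 * a / (B * r) * |Y| :=
    mul_le_mul_of_nonneg_left hlt.le (by positivity)
  rw [e1, e2]
  nlinarith

namespace IsUCBRun

variable {M : RewardModel n k B} {α : ℝ} {T : ℕ} {mΩ : MeasurableSpace Ω} {P : Measure Ω}
  {ℱ : Filtration ℕ mΩ} {S : ℕ → Ω → KSet n k} {X : ℕ → Ω → Fin n → ℝ}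

theorem measureReal_deviationEvent_le (h : IsUCBRun M α T P ℱ S X) [IsProbabilityMeasure P]
    (hT : 2 ≤ T) : P.real (deviationEvent M α T S X) ≤ 2 * n / (T : ℝ) ^ 2 := by
  have hTpos : (0 : ℝ) < T := by positivity
  refine (measureReal_biUnion_finset_le _ _).trans ?_
  -- Union over `2nT²` events (time, arm, pull count, sign). The pull count is random, so each value
  -- gets its own parameter.
  refine (Finset.sum_le_card_nsmul _ _ (1 / (T : ℝ) ^ 4) ?_).trans ?_
  · intro q hq
    simp only [Finset.mem_product, Finset.mem_range] at hq
    exact h.measureReal_expDeviation_ge _ hq.1.1.le _ (by positivity)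
  · have hc : ({1, -1} : Finset ℝ).card = 2 := Finset.card_pair (by norm_num)
    rw [Finset.card_product, Finset.card_product, Finset.card_product, hc, nsmul_eq_mul]
    simp only [Finset.card_range, Finset.card_univ, Fintype.card_fin]
    push_cast
    apply le_of_eq
    field_simp

theorem measurableSet_deviationEvent (h : IsUCBRun M α T P ℱ S X) :
    MeasurableSet (deviationEvent M α T S X) := by
  refine Finset.measurableSet_biUnion _ fun q hq => ?_
  simp only [Finset.mem_product, Finset.mem_range] at hq
  have := (h.measurable_expDeviation
    (q.2.2 * (4 * Real.sqrt (α * Real.log T) / (B * Real.sqrt q.2.1))) hq.1.1.le q.1.2).mono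
    (ℱ.le _) le_rfl
  have h2 : Measurable fun ω => expDeviation M S X
      (q.2.2 * (4 * Real.sqrt (α * Real.log T) / (B * Real.sqrt q.2.1))) q.1.1 q.1.2 ω := by
    convert this.ennreal_toReal using 2 with ω
    exact (ENNReal.toReal_ofReal (Real.exp_pos _).le).symm
  exact measurableSet_le measurable_const h2

/-! ### From path bounds to the expected regret -/

theorem pairwise_disjoint_select (S : ℕ → Ω → KSet n k) (t : ℕ) :
    Pairwise (Function.onFun Disjoint fun s : KSet n k => {ω | S t ω = s}) := by
  intro s s' hs
  rw [Function.onFun, Set.disjoint_left]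
  intro ω h1 h2
  exact hs (h1.symm.trans h2)

theorem integral_reward (h : IsUCBRun M α T P ℱ S X) [IsProbabilityMeasure P] {t : ℕ}
    (ht : t < T) :
    ∫ ω, ∑ i ∈ (S t ω).1, X t ω i ∂P = ∫ ω, M.setMean (S t ω) ∂P := by
  have hms := fun s => h.measurableSet_select ht s
  have huniv : ⋃ s : KSet n k, {ω | S t ω = s} = Set.univ := by ext; simp
  have hX := h.measurable_reward ht
  have hmap : ∀ s : KSet n k,
      (P.restrict {ω | S t ω = s}).map (X t) = P {ω | S t ω = s} • M.law s := by
    intro s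
    have := h.map_restrict ht s (A := Set.univ) MeasurableSet.univ
    rwa [Set.univ_inter] at this
  have hq : ∀ s : KSet n k, Measurable fun x : Fin n → ℝ => ∑ i ∈ s.1, x i := by
    intro s; fun_prop
  have hint : ∀ s : KSet n k, IntegrableOn (fun ω => ∑ i ∈ (S t ω).1, X t ω i)
      {ω | S t ω = s} P := by
    intro s
    have h1 : Integrable (fun x : Fin n → ℝ => ∑ i ∈ s.1, x i)
        ((P.restrict {ω | S t ω = s}).map (X t)) := by
      rw [hmap]
      exact (integrable_finsetSum _ fun i hi => M.integrable_coord s hi).smul_measure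
        (measure_ne_top _ _)
    have h2 := (integrable_map_measure (hq s).aestronglyMeasurable hX.aemeasurable).1 h1
    refine IntegrableOn.congr_fun (f := (fun x : Fin n → ℝ => ∑ i ∈ s.1, x i) ∘ X t) h2 ?_ (hms s)
    intro ω hω
    have hω : S t ω = s := hω
    simp [hω]
  have hint2 : ∀ s : KSet n k, IntegrableOn (fun ω => M.setMean (S t ω)) {ω | S t ω = s} P := by
    intro s
    refine IntegrableOn.congr_fun (f := fun _ => M.setMean s) integrableOn_const ?_ (hms s)
    intro ω hω
    have hω : S t ω = s := hω
    simp [hω]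
  rw [← setIntegral_univ, ← setIntegral_univ (f := fun ω => M.setMean (S t ω)), ← huniv,
    integral_iUnion_fintype hms (pairwise_disjoint_select S t) hint,
    integral_iUnion_fintype hms (pairwise_disjoint_select S t) hint2]
  refine Finset.sum_congr rfl fun s _ => ?_
  rw [setIntegral_congr_fun (f := fun ω => ∑ i ∈ (S t ω).1, X t ω i)
      (g := fun ω => ∑ i ∈ s.1, X t ω i) (hms s) (by
      intro ω hω
      have hω : S t ω = s := hω
      simp [hω]),
    setIntegral_congr_fun (f := fun ω => M.setMean (S t ω)) (g := fun _ => M.setMean s) (hms s) (by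
      intro ω hω
      have hω : S t ω = s := hω
      simp [hω])]
  have h3 := integral_map (μ := P.restrict {ω | S t ω = s}) hX.aemeasurable
    (hq s).aestronglyMeasurable
  rw [← h3, hmap, integral_smul_measure, setIntegral_const]
  rfl

/-- A bound on the regret of every concentrated path bounds the expected regret. -/
theorem regret_le_of_path (h : IsUCBRun M α T P ℱ S X) [IsProbabilityMeasure P] (hT : 2 ≤ T)
    (hα : 2 ≤ α) (hB : 0 < B) {sstar : KSet n k} {V : ℝ} (hV : 0 ≤ V)
    (hpath : ∀ ω, Concentrated M α T S X ω →
      (∀ t < T, ∀ i ∈ (S t ω).1, ∀ j ∉ (S t ω).1, ucb B α T S X t ω j ≤ ucb B α T S X t ω i) →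
      ∑ t ∈ Finset.range T, (M.setMean sstar - M.setMean (S t ω)) ≤ V) :
    regret M sstar T P S X ≤ V + k * B * T * (2 * n / (T : ℝ) ^ 2) := by
  have hTpos : (0 : ℝ) < T := by positivity
  have hmeas : ∀ t < T, Measurable fun ω => M.setMean (S t ω) := fun t ht =>
    (h.measurable_comp_select ht M.setMean).mono (ℱ.le t) le_rfl
  have hint : ∀ t < T, Integrable (fun ω => M.setMean (S t ω)) P := fun t ht =>
    Integrable.of_mem_Icc 0 (k * B) (hmeas t ht).aemeasurable
      (Filter.Eventually.of_forall fun ω => ⟨M.setMean_nonneg _, M.setMean_le _⟩)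
  have hint2 : ∀ t ∈ Finset.range T, Integrable (fun ω => M.setMean sstar - M.setMean (S t ω)) P :=
    fun t ht => (integrable_const _).sub (hint t (Finset.mem_range.1 ht))
  have hreg : regret M sstar T P S X =
      ∫ ω, ∑ t ∈ Finset.range T, (M.setMean sstar - M.setMean (S t ω)) ∂P := by
    rw [integral_finsetSum _ hint2, regret]
    refine Finset.sum_congr rfl fun t ht => ?_
    rw [h.integral_reward (Finset.mem_range.1 ht), integral_sub (integrable_const _)
      (hint t (Finset.mem_range.1 ht))]
    simp
  have hD := h.measurableSet_deviationEvent
  rw [hreg]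
  have hkB : 0 ≤ k * B * T := by positivity
  calc ∫ ω, ∑ t ∈ Finset.range T, (M.setMean sstar - M.setMean (S t ω)) ∂P
      ≤ ∫ ω, (V + (deviationEvent M α T S X).indicator (fun _ => k * B * T) ω) ∂P := by
        refine integral_mono_ae (integrable_finsetSum _ hint2)
          ((integrable_const _).add ((integrable_const _).indicator hD)) ?_
        have htop : ∀ᵐ ω ∂P, ∀ t < T, ∀ i ∈ (S t ω).1, ∀ j ∉ (S t ω).1,
            ucb B α T S X t ω j ≤ ucb B α T S X t ω i := by
          rw [ae_all_iff]; intro t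
          by_cases ht : t < T
          · filter_upwards [h.top_k t ht] with ω hω _ using hω
          · exact Filter.Eventually.of_forall fun ω h' => absurd h' ht
        filter_upwards [htop] with ω hω
        by_cases hm : ω ∈ deviationEvent M α T S X
        · rw [Set.indicator_of_mem hm]
          have : ∑ t ∈ Finset.range T, (M.setMean sstar - M.setMean (S t ω)) ≤
              ∑ t ∈ Finset.range T, k * B := Finset.sum_le_sum fun t _ => by
            linarith [M.setMean_le sstar, M.setMean_nonneg (S t ω)]
          rw [Finset.sum_const, Finset.card_range, nsmul_eq_mul] at this
          linarith
        · rw [Set.indicator_of_notMem hm, add_zero]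
          exact hpath ω (concentrated_of_notMem_deviationEvent M hT hα hB S X hm) hω
    _ = V + P.real (deviationEvent M α T S X) * (k * B * T) := by
        rw [integral_add (integrable_const _) ((integrable_const _).indicator hD),
          integral_indicator_const _ hD]
        simp
    _ ≤ V + k * B * T * (2 * n / (T : ℝ) ^ 2) := by
        rw [mul_comm (P.real _)]
        have := mul_le_mul_of_nonneg_left (h.measureReal_deviationEvent_le hT) hkB
        linarith

/-- Handles the case `n > T`, where the failure term of `regret_le_of_path` is too large, and the
degenerate cases `k = 0` and `B = 0`. -/
theorem regret_le_mul_horizon (h : IsUCBRun M α T P ℱ S X) [IsProbabilityMeasure P]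
    (sstar : KSet n k) : regret M sstar T P S X ≤ k * B * T := by
  have : regret M sstar T P S X ≤ ∑ t ∈ Finset.range T, (k * B : ℝ) := by
    refine Finset.sum_le_sum fun t ht => ?_
    rw [h.integral_reward (Finset.mem_range.1 ht)]
    have h1 : 0 ≤ ∫ ω, M.setMean (S t ω) ∂P := integral_nonneg fun ω => M.setMean_nonneg _
    linarith [M.setMean_le sstar]
  rw [Finset.sum_const, Finset.card_range, nsmul_eq_mul] at this
  linarith

end IsUCBRun

end Probability

/-! ### The two regret bounds and the theorem -/

variable {n k : ℕ} {B : ℝ}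

theorem one_le_mul_log {α : ℝ} {T : ℕ} (hT : 2 ≤ T) (hα : 2 ≤ α) : 1 ≤ α * Real.log T := by
  have h1 : Real.log 2 ≤ Real.log T := Real.log_le_log (by norm_num) (by exact_mod_cast hT)
  have h2 := Real.log_two_gt_d9
  nlinarith

namespace IsUCBRun

variable {Ω : Type*} {M : RewardModel n k B} {α : ℝ} {T : ℕ} {mΩ : MeasurableSpace Ω}
  {P : Measure Ω} {ℱ : Filtration ℕ mΩ} {S : ℕ → Ω → KSet n k} {X : ℕ → Ω → Fin n → ℝ}

/-- The path bound is of order `k^(3/2)`, and `√k ≤ k` is given away. The constant is `11 = 9 + 2`,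
shared with the gap bound; here `3 + 2` would do. -/
theorem regret_le_sqrt (h : IsUCBRun M α T P ℱ S X) [IsProbabilityMeasure P] (hT : 2 ≤ T)
    (hα : 2 ≤ α) (hB : 0 < B) (hk : 0 < k) {sstar : KSet n k} (hopt : M.IsOptimalSet sstar)
    (hc : M.WeakOptimalSetConsistency sstar) :
    regret M sstar T P S X ≤
      11 * ((k : ℝ) ^ 2 * B * Real.sqrt (α * n * T * Real.log T)) := by
  have hL := one_le_mul_log hT hα
  have hk1 : (1 : ℝ) ≤ k := by exact_mod_cast hk
  have hT1 : (2 : ℝ) ≤ T := by exact_mod_cast hT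
  have hn1 : (1 : ℝ) ≤ n := by
    have := Finset.card_le_univ sstar.1
    rw [sstar.2, Fintype.card_fin] at this
    exact_mod_cast (show 1 ≤ n by omega)
  set s := Real.sqrt (α * n * T * Real.log T) with hs
  have hkB : k * B ≤ (k : ℝ) ^ 2 * B := by nlinarith [mul_nonneg (sub_nonneg.2 hk1) hB.le]
  have hkB0 : 0 < k * B := by positivity
  have hle : ∀ x : ℝ, 0 ≤ x → x ^ 2 ≤ n * T → x ≤ s := by
    intro x hx hx2
    apply Real.le_sqrt_of_sq_le
    have : α * n * T * Real.log T = (α * Real.log T) * (n * T) := by ring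
    rw [this]
    nlinarith [show (0 : ℝ) ≤ n * T by positivity]
  by_cases hnT : (n : ℝ) ≤ T
  · have hV := h.regret_le_of_path hT hα hB (sstar := sstar)
      (V := k * (3 * (B * Real.sqrt (α * Real.log T)) * Real.sqrt (n * (k * T)))) (by positivity)
      fun ω hg htop => path_regret_le_sqrt hg hB.le (Real.one_le_sqrt.2 hL) hk hopt hc htop
    have e1 : Real.sqrt (α * Real.log T) * Real.sqrt (n * (k * T)) = Real.sqrt k * s := by
      rw [hs, ← Real.sqrt_mul (by linarith), ← Real.sqrt_mul (by linarith)]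
      congr 1; ring
    have e2 : k * (3 * (B * Real.sqrt (α * Real.log T)) * Real.sqrt (n * (k * T))) =
        3 * (k * B * s) * Real.sqrt k := by
      calc _ = 3 * (k * B) * (Real.sqrt (α * Real.log T) * Real.sqrt (n * (k * T))) := by ring
        _ = _ := by rw [e1]; ring
    have hsk : Real.sqrt k ≤ k := Real.sqrt_le_iff.2 ⟨by linarith, by nlinarith⟩
    have hs1 : 1 ≤ s := hle 1 zero_le_one (by nlinarith)
    have e3 : k * B * T * (2 * n / (T : ℝ) ^ 2) ≤ 2 * (k * B) := by
      have : k * B * T * (2 * n / (T : ℝ) ^ 2) = 2 * (k * B) * (n / T) := by field_simp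
      rw [this]
      exact mul_le_of_le_one_right (by positivity) ((div_le_one (by linarith)).2 hnT)
    have e4 : 3 * (k * B * s) * Real.sqrt k ≤ 3 * ((k : ℝ) ^ 2 * B * s) := by
      calc _ ≤ 3 * (k * B * s) * k := by gcongr
        _ = _ := by ring
    have e5 : k * B ≤ (k : ℝ) ^ 2 * B * s :=
      hkB.trans (le_mul_of_one_le_right (by positivity) hs1)
    rw [e2] at hV
    linarith
  · have h1 := h.regret_le_mul_horizon sstar
    have h2 : (T : ℝ) ≤ s := hle T (by linarith) (by nlinarith)
    have h3 : k * B * T ≤ (k : ℝ) ^ 2 * B * s := mul_le_mul hkB h2 (by linarith) (by positivity)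
    have h4 : 0 ≤ (k : ℝ) ^ 2 * B * s := by positivity
    linarith

theorem regret_le_gap (h : IsUCBRun M α T P ℱ S X) [IsProbabilityMeasure P] (hT : 2 ≤ T)
    (hα : 2 ≤ α) (hB : 0 < B) (hk : 0 < k) {sstar : KSet n k}
    (hc : M.WeakOptimalSetConsistency sstar) (hgap : 0 < M.gap sstar) :
    regret M sstar T P S X ≤
      11 * (α * (k : ℝ) ^ 2 * B ^ 2 * n * Real.log T / M.gap sstar) := by
  have hL := one_le_mul_log hT hα
  have hk1 : (1 : ℝ) ≤ k := by exact_mod_cast hk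
  have hT1 : (2 : ℝ) ≤ T := by exact_mod_cast hT
  have hn1 : (1 : ℝ) ≤ n := by
    have := Finset.card_le_univ sstar.1
    rw [sstar.2, Fintype.card_fin] at this
    exact_mod_cast (show 1 ≤ n by omega)
  have hε := M.gap_le_bound sstar hgap
  have hgap_le := fun s hs => M.gap_le sstar s hs
  set ε := M.gap sstar
  have hkB0 : 0 < k * B := by positivity
  set W := α * (k : ℝ) ^ 2 * B ^ 2 * n * Real.log T / ε with hW
  have hle : ∀ x : ℝ, 0 ≤ x → x ≤ n → k * B * x ≤ W := by
    intro x hx hxn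
    rw [hW, le_div_iff₀ hgap]
    have : α * (k : ℝ) ^ 2 * B ^ 2 * n * Real.log T = k * B * n * (k * B) * (α * Real.log T) := by
      ring
    rw [this]
    calc k * B * x * ε ≤ k * B * n * (k * B) := by gcongr
      _ ≤ _ := le_mul_of_one_le_right (by positivity) hL
  have hW0 : 0 ≤ W := by simpa using hle 0 le_rfl (by linarith)
  by_cases hnT : (n : ℝ) ≤ T
  · have hV := h.regret_le_of_path hT hα hB (sstar := sstar)
      (V := k * ((3 * (B * Real.sqrt (α * Real.log T))) ^ 2 * (n * k) / ε)) (by positivity)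
      fun ω hg htop => path_regret_le_gap hg hB.le (Real.one_le_sqrt.2 hL) hk hc htop hgap hgap_le
    -- The `9` is the square of the three widths; failed concentration adds `2 * (k * B) ≤ 2 * W`,
    -- which makes `11`.
    have e2 : k * ((3 * (B * Real.sqrt (α * Real.log T))) ^ 2 * (n * k) / ε) = 9 * W := by
      rw [hW, mul_pow, mul_pow, Real.sq_sqrt (by linarith)]; ring
    have e3 : k * B * T * (2 * n / (T : ℝ) ^ 2) ≤ 2 * (k * B) := by
      have : k * B * T * (2 * n / (T : ℝ) ^ 2) = 2 * (k * B) * (n / T) := by field_simp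
      rw [this]
      exact mul_le_of_le_one_right (by positivity) ((div_le_one (by linarith)).2 hnT)
    have := hle 1 zero_le_one hn1
    rw [e2] at hV
    linarith
  · have h1 := h.regret_le_mul_horizon sstar
    have := hle T (by linarith) (by linarith)
    linarith

end IsUCBRun

end SetBandit

theorem mainTheorem5 :
    ∃ K : ℝ, 0 < K ∧
      ∀ (n k T : ℕ) (B α : ℝ), 2 ≤ T → 2 ≤ α →
      ∀ (M : SetBandit.RewardModel n k B) (sstar : SetBandit.KSet n k),
        M.IsOptimalSet sstar → M.WeakOptimalSetConsistency sstar →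
      ∀ (Ω : Type*) (mΩ : MeasurableSpace Ω) (P : Measure Ω) (_ : IsProbabilityMeasure P)
        (ℱ : Filtration ℕ mΩ)
        (S : ℕ → Ω → SetBandit.KSet n k) (X : ℕ → Ω → Fin n → ℝ),
        SetBandit.IsUCBRun M α T P ℱ S X →
        (0 < M.gap sstar →
          SetBandit.regret M sstar T P S X ≤
            K * min (α * (k : ℝ) ^ 2 * B ^ 2 * (n : ℝ) * Real.log (T : ℝ) / M.gap sstar)
              ((k : ℝ) ^ 2 * B * Real.sqrt (α * (n : ℝ) * (T : ℝ) * Real.log (T : ℝ)))) ∧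
        SetBandit.regret M sstar T P S X ≤
          K * ((k : ℝ) ^ 2 * B * Real.sqrt (α * (n : ℝ) * (T : ℝ) * Real.log (T : ℝ))) := by
  refine ⟨11, by norm_num, ?_⟩
  intro n k T B α hT hα M sstar hopt hc Ω mΩ P hP ℱ S X h
  have htriv := h.regret_le_mul_horizon sstar
  -- Tuning the exponential parameter divides by `B`, so `B = 0` is treated apart; there, and for `k
  -- = 0`, the regret is at most `0`.
  rcases Nat.eq_zero_or_pos k with rfl | hk
  · exact ⟨fun _ => by simpa using htriv, by simpa using htriv⟩
  rcases (M.bound_nonneg sstar hk).eq_or_lt with rfl | hB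
  · exact ⟨fun _ => by simpa using htriv, by simpa using htriv⟩
  · have hsqrt := h.regret_le_sqrt hT hα hB hk hopt hc
    refine ⟨fun hgap => ?_, hsqrt⟩
    rw [mul_min_of_nonneg _ _ (by norm_num)]
    exact le_min (h.regret_le_gap hT hα hB hk hc hgap) hsqrt
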